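/- **Setting.** Let $(\mathsf G,\mathcal G,\nu)$ be a $\sigma$-finite measure space and let $\varpi:\mathsf G\to(0,\infty)$ be measurable with $c:=\int_{\mathsf G}\varpi\,d\nu\in(0,\infty)$ and $\sup\varpi=\operatorname{ess\,sup}_\nu\varpi$ (possibly infinite). Let $\pi(dx)=c^{-1}\varpi(x)\,\nu(dx)$. For $0<t<\sup\varpi$ put $\mathsf G(t)=\{x:\varpi(x)>t\}$ and $\nu_t(A)=\nu(A\cap \mathsf G(t))/\nu(\mathsf G(t))$. * $\mathsf{Slice}(\pi,\nu)$ is the ideal slice sampling kernel $$U(x,A)=\frac1{\varpi(x)}\int_0^{\varpi(x)}\nu_t(A)\,dt .$$ * For a proposal kernel $Q$ on $\mathsf G$, the Metropolis kernel is $$M(x,A)=\int_A a(x,y)\,Q(x,dy)+\mathbf 1_A(x)\Bigl(1-\int_{\mathsf G}a(x,y)\,Q(x,dy)\Bigr),\qquad a(x,y)=\min\{1,\varpi(y)/\varpi(x)\}.$$ * For a kernel $P$ on $\mathsf G$ and $f\in L^2(\pi)$, the Dirichlet form is $\mathcal E_\pi(P,f)=\langle(\mathrm{Id}-P)f,f\rangle_{\pi}$,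 where $Pf(x)=\int f(y)\,P(x,dy)$. We say that $P_1$ *dominates* $P_2$ if both are $\pi$-reversible Markov kernels and $\mathcal E_\pi(P_2,f)\le\mathcal E_\pi(P_1,f)$ for all $f\in L^2(\pi)$ with $\pi(f)=0$. **Corollary.** In each of the following three cases, $U$ dominates $M$. 1. (Random Walk Metropolis.) $\mathsf G\subseteq\mathbb R^d$ is a Borel set, $\nu$ is Lebesgue measure on $\mathsf G$, $\sigma>0$, and $Q(x,dy)=(2\pi\sigma^2)^{-d/2}\exp\bigl(-|x-y|^2/(2\sigma^2)\bigr)\,\nu(dy)$ (here, in the constant, $\pi$ is the number); if $\mathsf G\ne\mathbb R^d$, then proposals outside $\mathsf G$ are rejected, as the formula for $M$ expresses. Here $U=\mathsf{Slice}(\pi,\mathrm{Leb})$. 2. (Independent Metropolis.) $(\mathsf G,\mathcal G,\nu)$ is an arbitrary probability space and $Q(x,\cdot)=\nu$ for all $x$. Here $U=\mathsf{Slice}(\pi,\nu)$. 3. (Preconditioned Crank–Nicolson.) $\mathsf G$ is a real separable Hilbert space (of finite or infinite dimension) with its Borel $\sigma$-algebra, $\mathsf C$ is the injective covariance operator of a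 Gaussian measure on $\mathsf G$, $\nu=\mathcal N(0,\mathsf C)$, $s\in[0,1]$, and $Q(x,\cdot)=\mathcal N(\sqrt{1-s^2}\,x,\,s^2\mathsf C)$. Here $U=\mathsf{Slice}(\pi,\mathcal N(0,\mathsf C))$. -/

import Mathlib

open MeasureTheory ProbabilityTheory
open scoped ENNReal

/-! ### Kernels, Dirichlet forms and domination -/

/-- The Dirichlet form `⟨(Id - P) f, f⟩` in `L²(μ)`, where `P f (x) = ∫ f(y) P(x, dy)`. -/
noncomputable def dirichletForm {G : Type*} [MeasurableSpace G] (μ : Measure G)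
    (P : Kernel G G) (f : G → ℝ) : ℝ :=
  ∫ x, (f x - ∫ y, f y ∂(P x)) * f x ∂μ

/-- `P₁` dominates `P₂`: both are `μ`-reversible Markov kernels, and the Dirichlet form of `P₂` is
at most that of `P₁` at every square-integrable function of mean zero. -/
structure Dominates {G : Type*} [MeasurableSpace G] (μ : Measure G) (P₁ P₂ : Kernel G G) :
    Prop where
  markov_left : IsMarkovKernel P₁
  markov_right : IsMarkovKernel P₂
  reversible_left : Kernel.IsReversible P₁ μ
  reversible_right : Kernel.IsReversible P₂ μ
  le : ∀ f : G → ℝ, MemLp f 2 μ → ∫ x, f x ∂μ = 0 →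
    dirichletForm μ P₂ f ≤ dirichletForm μ P₁ f

/-- `w` is a strictly positive, not necessarily normalized density of `π` with respect to `ν`:
`π(dx) = c⁻¹ w(x) ν(dx)` with `c = ∫ w dν ∈ (0, ∞)`; moreover the supremum of `w` (which may be
infinite) coincides with its `ν`-essential supremum. -/
structure IsUnnormalizedDensity {G : Type*} [MeasurableSpace G] (π ν : Measure G) (w : G → ℝ) :
    Prop where
  measurable : Measurable w
  pos : ∀ x, 0 < w x
  mass_ne_zero : ∫⁻ x, ENNReal.ofReal (w x) ∂ν ≠ 0
  mass_ne_top : ∫⁻ x, ENNReal.ofReal (w x) ∂ν ≠ ∞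
  iSup_eq_essSup : ⨆ x, ENNReal.ofReal (w x) = essSup (fun x => ENNReal.ofReal (w x)) ν
  eq_withDensity :
    π = (∫⁻ x, ENNReal.ofReal (w x) ∂ν)⁻¹ • ν.withDensity (fun x => ENNReal.ofReal (w x))

/-! ### Ideal slice sampling -/

/-- The superlevel set `{x | w(x) > t}`. -/
def slice {G : Type*} (w : G → ℝ) (t : ℝ) : Set G := {x | t < w x}

/-- The kernel `t ↦ ν_t`, where `ν_t(A) = ν(A ∩ {w > t}) / ν({w > t})`. -/
noncomputable def onSliceKernel {G : Type*} [MeasurableSpace G] (ν : Measure G) (w : G → ℝ) :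
    Kernel ℝ G where
  toFun t := (ν (slice w t))⁻¹ • ν.restrict (slice w t)
  measurable' := by
    refine Measure.measurable_of_measurable_coe _ fun A hA => ?_
    have key : ∀ B : Set G, Measurable fun t : ℝ => ν (B ∩ slice w t) := fun B =>
      Antitone.measurable fun s t hst =>
        measure_mono (Set.inter_subset_inter_right B fun x (hx : t < w x) => lt_of_le_of_lt hst hx)
    have h1 := key Set.univ
    simp only [Set.univ_inter] at h1
    simp only [Measure.smul_apply, Measure.restrict_apply hA, smul_eq_mul]
    exact h1.inv.mul (key A)

/-- The kernel sending `x` to the uniform distribution on the interval `(0, w(x))`. -/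
noncomputable def levelKernel {G : Type*} [MeasurableSpace G] (w : G → ℝ) (hw : Measurable w) :
    Kernel G ℝ where
  toFun x := (ENNReal.ofReal (w x))⁻¹ • (volume : Measure ℝ).restrict (Set.Ioo 0 (w x))
  measurable' := by
    refine Measure.measurable_of_measurable_coe _ fun B hB => ?_
    have h : Measurable fun r : ℝ => (volume : Measure ℝ) (B ∩ Set.Ioo 0 r) :=
      Monotone.measurable fun s t hst =>
        measure_mono (Set.inter_subset_inter_right B (Set.Ioo_subset_Ioo_right hst))
    simp only [Measure.smul_apply, Measure.restrict_apply hB, smul_eq_mul]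
    exact hw.ennreal_ofReal.inv.mul (h.comp hw)

/-- Ideal slice sampling: draw `t` uniformly in `(0, w(x))`, then draw the next state from `ν_t`. -/
noncomputable def idealSlice {G : Type*} [MeasurableSpace G] (ν : Measure G) (w : G → ℝ)
    (hw : Measurable w) : Kernel G G :=
  (onSliceKernel ν w).comp (levelKernel w hw)

/-- `U(x, A) = w(x)⁻¹ ∫_0^{w(x)} ν_t(A) dt`. -/
theorem idealSlice_apply {G : Type*} [MeasurableSpace G] (ν : Measure G) (w : G → ℝ)
    (hw : Measurable w) (x : G) {A : Set G} (hA : MeasurableSet A) :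
    idealSlice ν w hw x A = (ENNReal.ofReal (w x))⁻¹ *
      ∫⁻ t in Set.Ioo 0 (w x), (ν (slice w t))⁻¹ * ν (A ∩ slice w t) := by
  rw [idealSlice, Kernel.comp_apply' _ _ _ hA]
  simp [levelKernel, onSliceKernel, Measure.restrict_apply hA]

/-! ### Metropolis kernels -/

/-- The acceptance probability `min {1, w(y) / w(x)}`. -/
noncomputable def acceptProb {G : Type*} (w : G → ℝ) (x y : G) : ℝ≥0∞ :=
  min 1 (ENNReal.ofReal (w y / w x))

theorem measurable_acceptProb {G : Type*} [MeasurableSpace G] {w : G → ℝ} (hw : Measurable w) :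
    Measurable (Function.uncurry (acceptProb w)) :=
  measurable_const.min
    ((hw.comp measurable_snd).div (hw.comp measurable_fst)).ennreal_ofReal

/-- The Metropolis kernel with proposal kernel `Q` and acceptance probability `a = acceptProb w`:
`M(x, A) = ∫_A a(x, y) Q(x, dy) + 1_A(x) (1 - ∫ a(x, y) Q(x, dy))`. -/
noncomputable def metropolis {G : Type*} [MeasurableSpace G] (w : G → ℝ) (hw : Measurable w)
    (Q : Kernel G G) [IsSFiniteKernel Q] : Kernel G G where
  toFun x := (Q x).withDensity (acceptProb w x) +
    (1 - ∫⁻ y, acceptProb w x y ∂(Q x)) • Measure.dirac x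
  measurable' := by
    have ha := measurable_acceptProb hw
    refine Measure.measurable_of_measurable_coe _ fun A hA => ?_
    have h1 : Measurable fun x => ∫⁻ y in A, acceptProb w x y ∂(Q x) :=
      ha.setLIntegral_kernel_prod_right hA
    have h2 : Measurable fun x => ∫⁻ y, acceptProb w x y ∂(Q x) :=
      ha.lintegral_kernel_prod_right
    simp only [Measure.add_apply, Measure.smul_apply, withDensity_apply _ hA,
      Measure.dirac_apply' _ hA, smul_eq_mul]
    exact h1.add ((measurable_const.sub h2).mul (measurable_const.indicator hA))

/-! ### Gaussian random walk proposal on a subset of `ℝ^d` -/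

/-- The density `(2 π σ²)^{-d/2} exp(-|x - y|² / (2 σ²))`. -/
noncomputable def gaussianStepDensity {d : ℕ} (σ : ℝ) (x y : EuclideanSpace ℝ (Fin d)) : ℝ :=
  (Real.sqrt (2 * Real.pi * σ ^ 2))⁻¹ ^ d * Real.exp (-‖x - y‖ ^ 2 / (2 * σ ^ 2))

theorem measurable_gaussianStepDensity {d : ℕ} (σ : ℝ) :
    Measurable (Function.uncurry (gaussianStepDensity (d := d) σ)) := by
  unfold gaussianStepDensity Function.uncurry
  fun_prop

/-- Lebesgue measure on a subset `S` of `ℝ^d`, as a measure on the subtype `S`. -/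
noncomputable def lebesgueOn {d : ℕ} (S : Set (EuclideanSpace ℝ (Fin d))) : Measure S :=
  (volume : Measure (EuclideanSpace ℝ (Fin d))).comap Subtype.val

instance {d : ℕ} (S : Set (EuclideanSpace ℝ (Fin d))) : SigmaFinite (lebesgueOn S) := by
  refine ⟨⟨⟨fun n => Subtype.val ⁻¹'
    spanningSets (volume : Measure (EuclideanSpace ℝ (Fin d))) n, fun _ => trivial, fun n => ?_, ?_⟩⟩⟩
  · have h : MeasurableSet (Subtype.val ⁻¹'
        spanningSets (volume : Measure (EuclideanSpace ℝ (Fin d))) n : Set S) :=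
      measurable_subtype_coe (measurableSet_spanningSets _ n)
    exact ((Measure.comap_apply_le _ _ h.nullMeasurableSet).trans
      (measure_mono (Set.image_preimage_subset _ _))).trans_lt (measure_spanningSets_lt_top _ n)
  · rw [← Set.preimage_iUnion, iUnion_spanningSets, Set.preimage_univ]

/-- The proposal `Q_σ(x, dy) = q_σ(x, y) dy` on `S ⊆ ℝ^d`, where `q_σ = gaussianStepDensity σ`. -/
noncomputable def gaussianWalk {d : ℕ} (S : Set (EuclideanSpace ℝ (Fin d))) (σ : ℝ) :
    Kernel S S :=
  Kernel.withDensity (Kernel.const S (lebesgueOn S)) fun x y =>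
    ENNReal.ofReal (gaussianStepDensity σ (x : EuclideanSpace ℝ (Fin d)) y)

instance {d : ℕ} (S : Set (EuclideanSpace ℝ (Fin d))) (σ : ℝ) :
    IsSFiniteKernel (gaussianWalk S σ) :=
  Kernel.IsSFiniteKernel.withDensity _ fun _ _ => ENNReal.ofReal_ne_top

theorem gaussianWalk_apply {d : ℕ} (S : Set (EuclideanSpace ℝ (Fin d))) (σ : ℝ) (x : S) :
    gaussianWalk S σ x = (lebesgueOn S).withDensity fun y =>
      ENNReal.ofReal (gaussianStepDensity σ (x : EuclideanSpace ℝ (Fin d)) y) := by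
  rw [gaussianWalk, Kernel.withDensity_apply, Kernel.const_apply]
  exact ((measurable_gaussianStepDensity σ).comp
    (measurable_subtype_coe.prodMap measurable_subtype_coe)).ennreal_ofReal

/-! ### Gaussian measures on Hilbert spaces and the preconditioned Crank–Nicolson proposal -/

/-- `μ` is a Gaussian measure with mean `m` and covariance operator `C`. -/
structure IsGaussianWith {H : Type*} [NormedAddCommGroup H] [InnerProductSpace ℝ H]
    [MeasurableSpace H] (m : H) (C : H →L[ℝ] H) (μ : Measure H) : Prop where
  isGaussian : IsGaussian μ
  mean : ∫ x, x ∂μ = m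
  cov : ∀ u v : H, ∫ x, inner ℝ u (x - m) * inner ℝ v (x - m) ∂μ = inner ℝ (C u) v

/-- `C` is the covariance operator of some (centred) Gaussian measure. -/
def IsGaussianCovariance {H : Type*} [NormedAddCommGroup H] [InnerProductSpace ℝ H]
    [MeasurableSpace H] (C : H →L[ℝ] H) : Prop :=
  ∃ μ : Measure H, IsGaussianWith 0 C μ

open Classical in
/-- The Gaussian measure `N(m, C)`; it is the zero measure if there is no Gaussian measure with
mean `m` and covariance operator `C`. -/
noncomputable def gaussianMeasure {H : Type*} [NormedAddCommGroup H] [InnerProductSpace ℝ H]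
    [MeasurableSpace H] (m : H) (C : H →L[ℝ] H) : Measure H :=
  if h : ∃ μ : Measure H, IsGaussianWith m C μ then h.choose else 0

section Gaussian

variable {H : Type*} [NormedAddCommGroup H] [InnerProductSpace ℝ H] [CompleteSpace H]
  [SecondCountableTopology H] [MeasurableSpace H] [BorelSpace H]

/-- A Gaussian measure is determined by its mean and its covariance operator. -/
theorem IsGaussianWith.eq {m : H} {C : H →L[ℝ] H} {μ ν : Measure H}
    (hμ : IsGaussianWith m C μ) (hν : IsGaussianWith m C ν) : μ = ν := by
  have := hμ.isGaussian
  have := hν.isGaussian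
  have h1 : μ[id] = m := hμ.mean
  have h2 : ν[id] = m := hν.mean
  refine IsGaussian.ext (h1.trans h2.symm) ?_
  ext u v
  rw [covarianceBilin_apply IsGaussian.memLp_two_id, covarianceBilin_apply IsGaussian.memLp_two_id,
    h1, h2, hμ.cov, hν.cov]

theorem IsGaussianWith.map_add {m : H} {C : H →L[ℝ] H} {μ : Measure H}
    (hμ : IsGaussianWith m C μ) (a : H) :
    IsGaussianWith (a + m) C (μ.map fun x => a + x) := by
  have := hμ.isGaussian
  refine ⟨inferInstance, ?_, fun u v => ?_⟩
  · have hint : Integrable (fun x : H => x) μ := IsGaussian.integrable_id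
    rw [integral_map (by fun_prop) (by fun_prop), integral_add (integrable_const _) hint, hμ.mean]
    simp
  · rw [integral_map (by fun_prop) (by fun_prop), ← hμ.cov u v]
    simp

theorem IsGaussianWith.gaussianMeasure_eq {m : H} {C : H →L[ℝ] H} {μ : Measure H}
    (hμ : IsGaussianWith m C μ) : gaussianMeasure m C = μ := by
  have h : ∃ μ : Measure H, IsGaussianWith m C μ := ⟨μ, hμ⟩
  rw [gaussianMeasure, dif_pos h]
  exact h.choose_spec.eq hμ

theorem gaussianMeasure_eq_map {C : H →L[ℝ] H} (hC : IsGaussianCovariance C) (m : H) :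
    gaussianMeasure m C = (gaussianMeasure 0 C).map fun x => m + x := by
  obtain ⟨μ, hμ⟩ := hC
  rw [hμ.gaussianMeasure_eq]
  have h := hμ.map_add m
  rw [add_zero] at h
  exact h.gaussianMeasure_eq

theorem gaussianMeasure_eq_zero {C : H →L[ℝ] H} (hC : ¬ IsGaussianCovariance C) (m : H) :
    gaussianMeasure m C = 0 := by
  refine dif_neg fun ⟨μ, hμ⟩ => hC ?_
  have h := hμ.map_add (-m)
  rw [neg_add_cancel] at h
  exact ⟨_, h⟩

theorem measurable_gaussianMeasure (C : H →L[ℝ] H) :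
    Measurable fun m : H => gaussianMeasure m C := by
  by_cases hC : IsGaussianCovariance C
  · have hfin : SFinite (gaussianMeasure 0 C) := by
      obtain ⟨μ, hμ⟩ := hC
      have := hμ.isGaussian
      rw [hμ.gaussianMeasure_eq]
      infer_instance
    refine Measure.measurable_of_measurable_coe _ fun A hA => ?_
    have h : ∀ m : H, gaussianMeasure m C A =
        gaussianMeasure 0 C (Prod.mk m ⁻¹' ((fun p : H × H => p.1 + p.2) ⁻¹' A)) := fun m => by
      rw [gaussianMeasure_eq_map hC, Measure.map_apply (by fun_prop) hA]
      rfl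
    simp only [h]
    exact measurable_measure_prodMk_left ((measurable_fst.add measurable_snd) hA)
  · simp only [gaussianMeasure_eq_zero hC]
    exact measurable_const

/-- The preconditioned Crank–Nicolson proposal `Q(x, ·) = N(√(1 - s²) x, s² C)`. -/
noncomputable def pcnProposal (C : H →L[ℝ] H) (s : ℝ) : Kernel H H where
  toFun x := gaussianMeasure (Real.sqrt (1 - s ^ 2) • x) (s ^ 2 • C)
  measurable' := (measurable_gaussianMeasure _).comp (measurable_const_smul _)

instance (C : H →L[ℝ] H) (s : ℝ) : IsFiniteKernel (pcnProposal C s) := by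
  refine ⟨1, ENNReal.one_lt_top, fun x => ?_⟩
  change gaussianMeasure _ _ Set.univ ≤ 1
  by_cases h : ∃ μ, IsGaussianWith (Real.sqrt (1 - s ^ 2) • x) (s ^ 2 • C) μ
  · obtain ⟨μ, hμ⟩ := h
    have := hμ.isGaussian
    rw [hμ.gaussianMeasure_eq, measure_univ]
  · rw [gaussianMeasure, dif_neg h]
    simp

end Gaussian

/-! For a reversible kernel `P`, the Dirichlet form is half the integral of (f(x) - f(y))² over the
joint law π ⊗ P (`dirichletForm_eq_half`), so only the joint laws matter, and anything carried by
the diagonal is invisible.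

Both joint laws decompose over the levels t > 0. With D = {w > t} and c = ∫ w dν, the slice sampler
contributes c⁻¹ ν(D)⁻¹ (ν × ν) restricted to D × D (`lintegral_compProd_idealSlice`). The accepted
Metropolis moves have law c⁻¹ min(w(x), w(y)) ν(dx) Q(x, dy), which the layer-cake formula turns
into the restrictions of c⁻¹ ν ⊗ Q to D × D (`lintegral_ofReal_min_mul`).

It remains to compare at a fixed level (`setLIntegral_sq_sub_le`). Let g be f minus its mean over D.
Independent sampling on D has energy exactly 2 ∫_D g². The proposal has energy at most 2 ∫_D g²
minus twice the correlation of 1_D g under ν ⊗ Q, and this correlation is nonnegative when Q is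
positive semidefinite.

Positivity of the three proposals has one source: under ν ⊗ Q the two states are conditionally
independent with a common conditional law, so correlations are integrals of squares
(`isPositiveProposal_of_compProd_eq`). Each case amounts to finding the hidden variable: a midway
point of a Gaussian step, nothing at all, or an autoregressive step whose coefficient is the square
root of the original one. -/

/-! ### Energy comparison on a single set -/

/-- Integral of the squared difference in terms of the marginals and the correlation. -/
theorem integral_sq_sub_eq {G : Type*} [MeasurableSpace G] {ρ : Measure (G × G)} {g : G → ℝ}
    (h1 : MemLp (fun p : G × G => g p.1) 2 ρ) (h2 : MemLp (fun p : G × G => g p.2) 2 ρ) :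
    Integrable (fun p : G × G => (g p.1 - g p.2) ^ 2) ρ ∧
    ∫ p, (g p.1 - g p.2) ^ 2 ∂ρ =
      ∫ p, g p.1 ^ 2 ∂ρ + ∫ p, g p.2 ^ 2 ∂ρ - 2 * ∫ p, g p.1 * g p.2 ∂ρ := by
  have h12 : Integrable (fun p : G × G => g p.1 * g p.2) ρ := h1.integrable_mul h2
  refine ⟨(h1.sub h2).integrable_sq, ?_⟩
  have hadd : Integrable (fun p : G × G => g p.1 ^ 2 + g p.2 ^ 2) ρ :=
    h1.integrable_sq.add h2.integrable_sq
  rw [← integral_add h1.integrable_sq h2.integrable_sq, ← integral_const_mul,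
    ← integral_sub hadd (h12.const_mul 2)]
  exact integral_congr_ae (Filter.Eventually.of_forall fun p => by simp only; ring)

theorem memLp_comp_of_map_le {α β : Type*} [MeasurableSpace α] [MeasurableSpace β]
    {ρ : Measure α} {μ : Measure β} {φ : α → β} (hφ : Measurable φ) (hle : ρ.map φ ≤ μ)
    {g : β → ℝ} (hg : MemLp g 2 μ) : MemLp (fun p => g (φ p)) 2 ρ :=
  (hg.mono_measure hle).comp_of_map hφ.aemeasurable

theorem integral_sq_comp_le {α β : Type*} [MeasurableSpace α] [MeasurableSpace β]
    {ρ : Measure α} {μ : Measure β} {φ : α → β} (hφ : Measurable φ) (hle : ρ.map φ ≤ μ)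
    {g : β → ℝ} (hg : MemLp g 2 μ) : ∫ p, g (φ p) ^ 2 ∂ρ ≤ ∫ x, g x ^ 2 ∂μ := by
  rw [← integral_map (f := fun x => g x ^ 2) hφ.aemeasurable
    (hg.mono_measure hle).integrable_sq.aestronglyMeasurable]
  exact integral_mono_measure hle (Filter.Eventually.of_forall fun x => sq_nonneg _)
    hg.integrable_sq

/-- A proposal kernel that is sub-Markov, reversible and positive semidefinite with respect to `ν`. -/
structure IsPositiveProposal {G : Type*} [MeasurableSpace G] (ν : Measure G) (Q : Kernel G G) :
    Prop where
  le_one : ∀ x, Q x Set.univ ≤ 1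
  map_swap : (ν ⊗ₘ Q).map Prod.swap = ν ⊗ₘ Q
  nonneg : ∀ g : G → ℝ, Measurable g → Integrable (fun p : G × G => g p.1 * g p.2) (ν ⊗ₘ Q) →
    0 ≤ ∫ p, g p.1 * g p.2 ∂(ν ⊗ₘ Q)

section

variable {G : Type*} [MeasurableSpace G] {ν : Measure G} [SFinite ν] {Q : Kernel G G}
  [IsSFiniteKernel Q]

/-- Moves that leave D and the sub-Markov deficit of `Q` only remove mass. An inequality suffices,
since the marginal second moments enter the proposal's energy with a plus sign. -/
theorem IsPositiveProposal.restrict_map_fst_le (hQ : IsPositiveProposal ν Q) {D : Set G}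
    (hD : MeasurableSet D) :
    ((ν ⊗ₘ Q).restrict (D ×ˢ D)).map Prod.fst ≤ ν.restrict D := by
  refine Measure.le_iff.2 fun A hA => ?_
  rw [Measure.map_apply measurable_fst hA, Measure.restrict_apply (measurable_fst hA),
    Measure.restrict_apply hA]
  have hsub : Prod.fst ⁻¹' A ∩ D ×ˢ D ⊆ (A ∩ D) ×ˢ (Set.univ : Set G) :=
    fun p hp => ⟨⟨hp.1, hp.2.1⟩, trivial⟩
  refine (measure_mono hsub).trans ?_
  rw [Measure.compProd_apply_prod (hA.inter hD) MeasurableSet.univ]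
  calc ∫⁻ x in A ∩ D, Q x Set.univ ∂ν ≤ ∫⁻ _ in A ∩ D, 1 ∂ν := lintegral_mono fun x => hQ.le_one x
    _ = ν (A ∩ D) := by simp

theorem IsPositiveProposal.restrict_map_snd_le (hQ : IsPositiveProposal ν Q) {D : Set G}
    (hD : MeasurableSet D) :
    ((ν ⊗ₘ Q).restrict (D ×ˢ D)).map Prod.snd ≤ ν.restrict D := by
  have h : ((ν ⊗ₘ Q).restrict (D ×ˢ D)).map Prod.snd
      = ((ν ⊗ₘ Q).restrict (D ×ˢ D)).map Prod.fst := by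
    conv_lhs => rw [← hQ.map_swap, Measure.restrict_map measurable_swap (hD.prod hD)]
    rw [Measure.map_map measurable_snd measurable_swap, Set.preimage_swap_prod]
    rfl
  rw [h]
  exact hQ.restrict_map_fst_le hD

/-- Restricted to a set of finite measure, the off-diagonal energy of a positive sub-Markov proposal
is at most the one of independent sampling. -/
theorem IsPositiveProposal.setLIntegral_sq_sub_le (hQ : IsPositiveProposal ν Q) {D : Set G}
    (hD : MeasurableSet D) (hνD : ν D ≠ ∞) {f : G → ℝ} (hf : Measurable f)
    (hf2 : MemLp f 2 (ν.restrict D)) :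
    ∫⁻ p in D ×ˢ D, ENNReal.ofReal ((f p.1 - f p.2) ^ 2) ∂(ν ⊗ₘ Q) ≤
      (ν D)⁻¹ * ∫⁻ p in D ×ˢ D, ENNReal.ofReal ((f p.1 - f p.2) ^ 2) ∂(ν.prod ν) := by
  -- For a null set the factor (ν D)⁻¹ is ∞, but the left side already vanishes.
  rcases eq_or_ne (ν D) 0 with h0 | h0
  · have : (ν ⊗ₘ Q) (D ×ˢ D) = 0 := by
      rw [Measure.compProd_apply_prod hD hD, Measure.restrict_eq_zero.2 h0, lintegral_zero_measure]
    rw [Measure.restrict_eq_zero.2 this, lintegral_zero_measure]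
    exact zero_le
  have : IsFiniteMeasure (ν.restrict D) := ⟨by simpa using hνD.lt_top⟩
  have hνpos : 0 < (ν D).toReal := ENNReal.toReal_pos h0 hνD
  -- Centring on D leaves increments unchanged and kills the cross term of independent sampling.
  set m : ℝ := (ν D).toReal⁻¹ * ∫ x in D, f x ∂ν with hm
  set g : G → ℝ := fun x => f x - m with hg
  have hgm : Measurable g := hf.sub_const m
  have hg2 : MemLp g 2 (ν.restrict D) := hf2.sub (memLp_const m)
  have hg0 : ∫ x in D, g x ∂ν = 0 := by
    rw [hg, integral_sub (hf2.integrable (by norm_num)) (integrable_const m)]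
    simp only [integral_const, smul_eq_mul, hm, Measure.real, Measure.restrict_apply_univ]
    field_simp
    ring
  have hfg : ∀ p : G × G, f p.1 - f p.2 = g p.1 - g p.2 := fun p => by simp [hg]
  simp only [hfg]
  have e1 := integral_sq_sub_eq
    (memLp_comp_of_map_le measurable_fst (hQ.restrict_map_fst_le hD) hg2)
    (memLp_comp_of_map_le measurable_snd (hQ.restrict_map_snd_le hD) hg2)
  have i1 := integral_sq_comp_le measurable_fst (hQ.restrict_map_fst_le hD) hg2
  have i2 := integral_sq_comp_le measurable_snd (hQ.restrict_map_snd_le hD) hg2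
  -- Positivity of `Q` is applied to g cut off outside D.
  have hcross : 0 ≤ ∫ p in D ×ˢ D, g p.1 * g p.2 ∂(ν ⊗ₘ Q) := by
    have hind : (fun p : G × G => D.indicator g p.1 * D.indicator g p.2)
        = (D ×ˢ D).indicator fun p => g p.1 * g p.2 := by
      ext p
      by_cases h1 : p.1 ∈ D <;> by_cases h2 : p.2 ∈ D <;> simp [h1, h2, Set.indicator]
    have := hQ.nonneg (D.indicator g) (hgm.indicator hD)
    rw [hind, integrable_indicator_iff (hD.prod hD), integral_indicator (hD.prod hD)] at this
    exact this ((memLp_comp_of_map_le measurable_fst (hQ.restrict_map_fst_le hD) hg2).integrable_mul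
      (memLp_comp_of_map_le measurable_snd (hQ.restrict_map_snd_le hD) hg2))
  rw [← Measure.prod_restrict]
  have e2 := integral_sq_sub_eq (ρ := (ν.restrict D).prod (ν.restrict D)) (g := g)
    (hg2.comp_fst _) (hg2.comp_snd _)
  rw [integral_prod_mul, hg0, integral_fun_fst (fun x => g x ^ 2),
    integral_fun_snd (fun x => g x ^ 2)] at e2
  rw [← ofReal_integral_eq_lintegral_ofReal e1.1 (Filter.Eventually.of_forall fun p => sq_nonneg _),
    ← ofReal_integral_eq_lintegral_ofReal e2.1 (Filter.Eventually.of_forall fun p => sq_nonneg _),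
    ← ENNReal.ofReal_toReal (ENNReal.inv_ne_top.2 h0),
    ← ENNReal.ofReal_mul ENNReal.toReal_nonneg, e1.2, e2.2, ENNReal.toReal_inv]
  refine ENNReal.ofReal_le_ofReal ?_
  simp only [smul_eq_mul, Measure.real, Measure.restrict_apply_univ]
  have : (ν D).toReal⁻¹ * ((ν D).toReal * ∫ x in D, g x ^ 2 ∂ν + (ν D).toReal * ∫ x in D, g x ^ 2 ∂ν
      - 2 * (0 * 0)) = 2 * ∫ x in D, g x ^ 2 ∂ν := by
    field_simp
    ring
  rw [this]
  linarith

end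

/-! ### Dirichlet forms and reversibility -/

/-- The Dirichlet form of a reversible Markov kernel as a mean squared increment. -/
theorem dirichletForm_eq_half {G : Type*} [MeasurableSpace G] {μ : Measure G} [SFinite μ]
    {P : Kernel G G} [IsMarkovKernel P] (hinv : Kernel.Invariant P μ) {f : G → ℝ}
    (hf : MemLp f 2 μ) :
    Integrable (fun p : G × G => (f p.1 - f p.2) ^ 2) (μ ⊗ₘ P) ∧
      dirichletForm μ P f = 2⁻¹ * ∫ p, (f p.1 - f p.2) ^ 2 ∂(μ ⊗ₘ P) := by
  have hfst : (μ ⊗ₘ P).map Prod.fst = μ := Measure.fst_compProd μ P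
  -- Invariance makes the second marginal μ too, so both squared terms integrate to ∫ f² dμ.
  have hsnd : (μ ⊗ₘ P).map Prod.snd = μ := (Measure.snd_compProd μ P).trans hinv
  have h1 := memLp_comp_of_map_le measurable_fst hfst.le hf
  have h2 := memLp_comp_of_map_le measurable_snd hsnd.le hf
  have h12 : Integrable (fun p : G × G => f p.1 * f p.2) (μ ⊗ₘ P) := h1.integrable_mul h2
  obtain ⟨hi, he⟩ := integral_sq_sub_eq h1 h2
  refine ⟨hi, ?_⟩
  have a1 : ∫ p, f p.1 ^ 2 ∂(μ ⊗ₘ P) = ∫ x, f x ^ 2 ∂μ := by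
    conv_rhs => rw [← hfst]
    rw [integral_map measurable_fst.aemeasurable]
    rw [hfst]; exact hf.integrable_sq.aestronglyMeasurable
  have a2 : ∫ p, f p.2 ^ 2 ∂(μ ⊗ₘ P) = ∫ x, f x ^ 2 ∂μ := by
    conv_rhs => rw [← hsnd]
    rw [integral_map measurable_snd.aemeasurable]
    rw [hsnd]; exact hf.integrable_sq.aestronglyMeasurable
  have hc := Measure.integral_compProd h12
  have hci := Integrable.integral_compProd (κ := Kernel.const Unit μ) (a := ())
    (η := Kernel.prodMkLeft Unit P) h12
  simp only [Kernel.const_apply, Kernel.prodMkLeft_apply, integral_const_mul] at hc hci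
  have hd : dirichletForm μ P f = ∫ x, f x ^ 2 ∂μ - ∫ p, f p.1 * f p.2 ∂(μ ⊗ₘ P) := by
    rw [hc, ← integral_sub hf.integrable_sq hci, dirichletForm]
    exact integral_congr_ae (Filter.Eventually.of_forall fun x => by simp only; ring)
  rw [hd, he, a1, a2]
  ring

/-- By invariance, a μ-null set is `P x`-null for μ-almost every x. This permits passing to a
measurable representative of f. -/
theorem dirichletForm_congr_ae {G : Type*} [MeasurableSpace G] {μ : Measure G}
    {P : Kernel G G} (hinv : Kernel.Invariant P μ) {f g : G → ℝ} (hfg : f =ᵐ[μ] g) :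
    dirichletForm μ P f = dirichletForm μ P g := by
  have h : ∀ᵐ x ∂μ, f =ᵐ[P x] g := by
    refine Measure.ae_ae_of_ae_comp ?_
    rw [hinv.def]
    exact hfg
  refine integral_congr_ae ?_
  filter_upwards [h, hfg] with x hx hx'
  rw [hx', integral_congr_ae hx]

/-- A kernel is reversible as soon as its joint law with the reference measure is exchangeable. -/
theorem isReversible_of_map_swap {G : Type*} [MeasurableSpace G] {μ : Measure G} [SFinite μ]
    {P : Kernel G G} [IsSFiniteKernel P] (h : (μ ⊗ₘ P).map Prod.swap = μ ⊗ₘ P) :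
    Kernel.IsReversible P μ := by
  intro A B hA hB
  rw [← Measure.compProd_apply_prod hA hB, ← Measure.compProd_apply_prod hB hA]
  conv_lhs => rw [← h]
  rw [Measure.map_apply measurable_swap (hA.prod hB), Set.preimage_swap_prod]

/-! ### Joint law of the slice sampler -/

section

variable {G : Type*} [MeasurableSpace G]

theorem measurableSet_slice {w : G → ℝ} (hw : Measurable w) (t : ℝ) : MeasurableSet (slice w t) :=
  measurableSet_lt measurable_const hw

instance (ν : Measure G) (w : G → ℝ) : IsFiniteKernel (onSliceKernel ν w) := by
  refine ⟨1, ENNReal.one_lt_top, fun t => ?_⟩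
  change ((ν (slice w t))⁻¹ • ν.restrict (slice w t)) Set.univ ≤ 1
  simp [ENNReal.inv_mul_le_one]

/-- Integrating over the region under the graph, in either order. -/
theorem lintegral_lintegral_Ioo_eq {ν : Measure G} [SFinite ν] {w : G → ℝ} (hw : Measurable w)
    {h : G → ℝ → ℝ≥0∞} (hh : Measurable (Function.uncurry h)) :
    ∫⁻ x, ∫⁻ t in Set.Ioo 0 (w x), h x t ∂volume ∂ν =
      ∫⁻ t in Set.Ioi (0 : ℝ), ∫⁻ x in slice w t, h x t ∂ν := by
  have hS : MeasurableSet {p : G × ℝ | p.2 < w p.1} :=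
    measurableSet_lt measurable_snd (hw.comp measurable_fst)
  have h1 : ∀ x, ∫⁻ t in Set.Ioo 0 (w x), h x t ∂volume = ∫⁻ t in Set.Ioi (0 : ℝ),
      {p : G × ℝ | p.2 < w p.1}.indicator (Function.uncurry h) (x, t) := fun x => by
    have : ∀ t, {p : G × ℝ | p.2 < w p.1}.indicator (Function.uncurry h) (x, t)
        = (Set.Iio (w x)).indicator (h x) t := fun t => by
      by_cases ht : t < w x <;> simp [Set.indicator, ht]
    simp only [this]
    rw [lintegral_indicator measurableSet_Iio, Measure.restrict_restrict measurableSet_Iio,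
      Set.inter_comm, Set.Ioi_inter_Iio]
  simp only [h1]
  rw [lintegral_lintegral_swap (f := fun x t =>
    {p : G × ℝ | p.2 < w p.1}.indicator (Function.uncurry h) (x, t))
    (hh.indicator hS).aemeasurable]
  refine lintegral_congr fun t => ?_
  have : ∀ x, {p : G × ℝ | p.2 < w p.1}.indicator (Function.uncurry h) (x, t)
      = (slice w t).indicator (fun x => h x t) x := fun x => by
    by_cases ht : t < w x <;> simp [Set.indicator, ht, slice]
  simp only [this]
  rw [lintegral_indicator (measurableSet_slice hw t)]

variable {π ν : Measure G} {w : G → ℝ}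

theorem IsUnnormalizedDensity.lintegral_eq (hw : IsUnnormalizedDensity π ν w) {h : G → ℝ≥0∞}
    (hh : Measurable h) :
    ∫⁻ x, h x ∂π = (∫⁻ x, ENNReal.ofReal (w x) ∂ν)⁻¹ * ∫⁻ x, ENNReal.ofReal (w x) * h x ∂ν := by
  conv_lhs => rw [hw.eq_withDensity]
  rw [lintegral_smul_measure, smul_eq_mul,
    lintegral_withDensity_eq_lintegral_mul _ hw.measurable.ennreal_ofReal hh]
  rfl

theorem IsUnnormalizedDensity.isProbabilityMeasure (hw : IsUnnormalizedDensity π ν w) :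
    IsProbabilityMeasure π := by
  refine ⟨?_⟩
  have := hw.lintegral_eq (h := fun _ => 1) measurable_const
  simpa [ENNReal.inv_mul_cancel hw.mass_ne_zero hw.mass_ne_top] using this

/-- Markov's inequality for the integrable density. -/
theorem IsUnnormalizedDensity.measure_slice_ne_top (hw : IsUnnormalizedDensity π ν w) {t : ℝ}
    (ht : 0 < t) : ν (slice w t) ≠ ∞ := by
  refine ((measure_mono fun x (hx : t < w x) => ENNReal.ofReal_le_ofReal hx.le).trans_lt
    ((meas_ge_le_lintegral_div hw.measurable.ennreal_ofReal.aemeasurable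
      (ENNReal.ofReal_pos.2 ht).ne' ENNReal.ofReal_ne_top).trans_lt
        (ENNReal.div_lt_top hw.mass_ne_top (ENNReal.ofReal_pos.2 ht).ne'))).ne

/-- A null slice would force the essential supremum down to t, below the value w(x). This is where
equality of supremum and essential supremum enters. -/
theorem IsUnnormalizedDensity.measure_slice_ne_zero (hw : IsUnnormalizedDensity π ν w) {t : ℝ}
    {x : G} (ht : t < w x) : ν (slice w t) ≠ 0 := by
  intro h0
  have h1 : essSup (fun x => ENNReal.ofReal (w x)) ν ≤ ENNReal.ofReal t := by
    refine essSup_le_of_ae_le _ ?_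
    have : ∀ᵐ y ∂ν, ¬ t < w y := by
      rw [ae_iff]; simpa [slice] using h0
    filter_upwards [this] with y hy
    exact ENNReal.ofReal_le_ofReal (not_lt.1 hy)
  rw [← hw.iSup_eq_essSup] at h1
  have h2 := (le_iSup (fun x => ENNReal.ofReal (w x)) x).trans h1
  exact absurd h2 (not_le.2 ((ENNReal.ofReal_lt_ofReal_iff (hw.pos x)).2 ht))

theorem IsUnnormalizedDensity.isMarkovKernel_idealSlice (hw : IsUnnormalizedDensity π ν w) :
    IsMarkovKernel (idealSlice ν w hw.measurable) := by
  refine ⟨fun x => ⟨?_⟩⟩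
  rw [idealSlice_apply _ _ _ _ MeasurableSet.univ]
  have : ∀ t ∈ Set.Ioo 0 (w x), (ν (slice w t))⁻¹ * ν (Set.univ ∩ slice w t) = 1 := fun t ht => by
    rw [Set.univ_inter, ENNReal.inv_mul_cancel (hw.measure_slice_ne_zero ht.2)
      (hw.measure_slice_ne_top ht.1)]
  rw [setLIntegral_congr_fun measurableSet_Ioo this]
  simp [ENNReal.inv_mul_cancel (ENNReal.ofReal_pos.2 (hw.pos x)).ne' ENNReal.ofReal_ne_top]

/-- The joint law of two successive states of the slice sampler is a mixture over levels. -/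
theorem IsUnnormalizedDensity.lintegral_compProd_idealSlice [SFinite ν]
    (hw : IsUnnormalizedDensity π ν w) {F : G × G → ℝ≥0∞} (hF : Measurable F) :
    ∫⁻ p, F p ∂(π ⊗ₘ idealSlice ν w hw.measurable) =
      (∫⁻ x, ENNReal.ofReal (w x) ∂ν)⁻¹ * ∫⁻ t in Set.Ioi (0 : ℝ),
        (ν (slice w t))⁻¹ * ∫⁻ p in slice w t ×ˢ slice w t, F p ∂(ν.prod ν) := by
  have := hw.isProbabilityMeasure
  have := hw.isMarkovKernel_idealSlice
  rw [Measure.lintegral_compProd hF, hw.lintegral_eq hF.lintegral_kernel_prod_right']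
  congr 1
  have hmeas : Measurable (Function.uncurry
      fun (x : G) (t : ℝ) => ∫⁻ y, F (x, y) ∂(onSliceKernel ν w t)) := by
    have h := Measurable.lintegral_kernel_prod_right' (κ := Kernel.prodMkLeft G (onSliceKernel ν w))
      (f := fun q : (G × ℝ) × G => F (q.1.1, q.2)) (hF.comp (by fun_prop))
    exact h
  -- The density w(x) of π cancels the normalization of the uniform level on (0, w(x)).
  have h1 : ∀ x, ENNReal.ofReal (w x) * ∫⁻ y, F (x, y) ∂(idealSlice ν w hw.measurable x) =
      ∫⁻ t in Set.Ioo 0 (w x), ∫⁻ y, F (x, y) ∂(onSliceKernel ν w t) := fun x => by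
    rw [idealSlice, Kernel.lintegral_comp _ _ _ (g := fun y => F (x, y)) (by fun_prop)]
    change _ * ∫⁻ t, _ ∂((ENNReal.ofReal (w x))⁻¹ • (volume : Measure ℝ).restrict (Set.Ioo 0 (w x)))
      = _
    rw [lintegral_smul_measure, smul_eq_mul, ← mul_assoc, ENNReal.mul_inv_cancel
      (ENNReal.ofReal_pos.2 (hw.pos x)).ne' ENNReal.ofReal_ne_top, one_mul]
  simp only [h1]
  rw [lintegral_lintegral_Ioo_eq hw.measurable hmeas]
  refine lintegral_congr fun t => ?_
  change ∫⁻ x in slice w t, ∫⁻ y, F (x, y) ∂((ν (slice w t))⁻¹ • ν.restrict (slice w t)) ∂ν = _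
  simp only [lintegral_smul_measure, smul_eq_mul]
  rw [lintegral_const_mul _ hF.lintegral_prod_right', ← Measure.prod_restrict,
    lintegral_prod _ hF.aemeasurable]

/-- Every level contributes a multiple of a product measure with equal factors. -/
theorem IsUnnormalizedDensity.map_swap_compProd_idealSlice [SFinite ν]
    (hw : IsUnnormalizedDensity π ν w) :
    (π ⊗ₘ idealSlice ν w hw.measurable).map Prod.swap = π ⊗ₘ idealSlice ν w hw.measurable := by
  refine Measure.ext_of_lintegral _ fun F hF => ?_
  rw [lintegral_map hF measurable_swap, hw.lintegral_compProd_idealSlice hF,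
    hw.lintegral_compProd_idealSlice (F := fun p => F p.swap) (hF.comp measurable_swap)]
  congr 1
  refine lintegral_congr fun t => ?_
  congr 1
  rw [← Measure.prod_restrict]
  exact lintegral_prod_swap (f := F)

/-! ### Metropolis kernels -/

/-- The right side is symmetric in x and y, which is detailed balance, and as a minimum it has
product superlevel sets. -/
theorem ofReal_mul_acceptProb {G : Type*} {w : G → ℝ} (hpos : ∀ x, 0 < w x) (x y : G) :
    ENNReal.ofReal (w x) * acceptProb w x y = ENNReal.ofReal (min (w x) (w y)) := by
  have h : acceptProb w x y = ENNReal.ofReal (min 1 (w y / w x)) := by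
    rw [acceptProb, ENNReal.ofReal_min, ENNReal.ofReal_one]
  rw [h, ← ENNReal.ofReal_mul (hpos x).le, mul_min_of_nonneg _ _ (hpos x).le, mul_one,
    mul_div_cancel₀ _ (hpos x).ne']

variable {Q : Kernel G G}

/-- Layer-cake form of the off-diagonal part of the Metropolis transitions. -/
theorem lintegral_ofReal_min_mul [SFinite ν] (hw : Measurable w)
    {F : G × G → ℝ≥0∞} (hF : Measurable F) :
    ∫⁻ p, ENNReal.ofReal (min (w p.1) (w p.2)) * F p ∂(ν ⊗ₘ Q) =
      ∫⁻ t in Set.Ioi (0 : ℝ), ∫⁻ p in slice w t ×ˢ slice w t, F p ∂(ν ⊗ₘ Q) := by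
  have hmin : Measurable fun p : G × G => min (w p.1) (w p.2) :=
    (hw.comp measurable_fst).min (hw.comp measurable_snd)
  have h := lintegral_lintegral_Ioo_eq (ν := ν ⊗ₘ Q) hmin (h := fun p _ => F p)
    (hF.comp measurable_fst)
  -- A minimum exceeds t exactly when both entries do, so the slices are squares.
  have hs : ∀ t : ℝ, slice (fun p : G × G => min (w p.1) (w p.2)) t = slice w t ×ˢ slice w t :=
    fun t => by ext p; simp [slice]
  simp only [hs] at h
  rw [← h]
  refine lintegral_congr fun p => ?_
  simp [mul_comm]

/-- A proposal whose stationary transitions consist of two conditionally independent draws with a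
common conditional law is reversible and positive semidefinite. -/
theorem isPositiveProposal_of_compProd_eq {Z : Type*} [MeasurableSpace Z] [SFinite ν]
    {m : Measure Z} {K : Kernel Z G} [IsSFiniteKernel K] (hQ : ∀ x, Q x Set.univ ≤ 1)
    (h : ν ⊗ₘ Q = (K ×ₖ K) ∘ₘ m) : IsPositiveProposal ν Q := by
  refine ⟨hQ, ?_, fun g hg hint => ?_⟩
  · rw [h, Measure.map_comp _ _ measurable_swap]
    congr 1
    ext x : 1
    rw [Kernel.map_apply _ measurable_swap, Kernel.prod_apply, Measure.prod_swap]
  · rw [h, Measure.comp_eq_comp_const_apply] at hint ⊢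
    rw [Kernel.integral_comp hint]
    -- Given z, the inner integral is the square of the conditional mean of g.
    refine integral_nonneg fun z => ?_
    simp only [Kernel.prod_apply]
    rw [integral_prod_mul]
    exact mul_self_nonneg _

variable [IsSFiniteKernel Q]

/-- The rejection term restores all mass not accepted, including any deficit of `Q`; the truncated
subtraction is exact because the accepted mass is at most 1. -/
theorem isMarkovKernel_metropolis (hw : Measurable w) (hQ : ∀ x, Q x Set.univ ≤ 1) :
    IsMarkovKernel (metropolis w hw Q) := by
  refine ⟨fun x => ⟨?_⟩⟩
  change ((Q x).withDensity (acceptProb w x) +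
    (1 - ∫⁻ y, acceptProb w x y ∂(Q x)) • Measure.dirac x) Set.univ = 1
  have hle : ∫⁻ y, acceptProb w x y ∂(Q x) ≤ 1 := by
    calc ∫⁻ y, acceptProb w x y ∂(Q x) ≤ ∫⁻ _, 1 ∂(Q x) := lintegral_mono fun y => min_le_left _ _
      _ ≤ 1 := by simpa using hQ x
  simp [add_tsub_cancel_of_le hle]

/-- Separates accepted moves from rejections. The latter sit on the diagonal, so they contribute
nothing to a squared increment. -/
theorem IsUnnormalizedDensity.lintegral_compProd_metropolis [SFinite ν]
    (hw : IsUnnormalizedDensity π ν w) (hQ : ∀ x, Q x Set.univ ≤ 1) {F : G × G → ℝ≥0∞}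
    (hF : Measurable F) :
    ∫⁻ p, F p ∂(π ⊗ₘ metropolis w hw.measurable Q) =
      (∫⁻ x, ENNReal.ofReal (w x) ∂ν)⁻¹ *
        ∫⁻ p, ENNReal.ofReal (min (w p.1) (w p.2)) * F p ∂(ν ⊗ₘ Q) +
      ∫⁻ x, (1 - ∫⁻ y, acceptProb w x y ∂(Q x)) * F (x, x) ∂π := by
  have := hw.isProbabilityMeasure
  have := isMarkovKernel_metropolis hw.measurable hQ
  have ha := measurable_acceptProb hw.measurable
  have hm : Measurable fun p : G × G => acceptProb w p.1 p.2 * F p := ha.mul hF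
  have hm2 : Measurable fun p : G × G => ENNReal.ofReal (min (w p.1) (w p.2)) * F p :=
    ((hw.measurable.comp measurable_fst).min
      (hw.measurable.comp measurable_snd)).ennreal_ofReal.mul hF
  rw [Measure.lintegral_compProd hF, Measure.lintegral_compProd hm2]
  have h1 : ∀ x, ∫⁻ y, F (x, y) ∂(metropolis w hw.measurable Q x) =
      ∫⁻ y, acceptProb w x y * F (x, y) ∂(Q x) +
        (1 - ∫⁻ y, acceptProb w x y ∂(Q x)) * F (x, x) := fun x => by
    change ∫⁻ y, F (x, y) ∂((Q x).withDensity (acceptProb w x) +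
      (1 - ∫⁻ y, acceptProb w x y ∂(Q x)) • Measure.dirac x) = _
    rw [lintegral_add_measure, lintegral_smul_measure, smul_eq_mul,
      lintegral_dirac' (f := fun y => F (x, y)) _ (by fun_prop),
      lintegral_withDensity_eq_lintegral_mul (f := acceptProb w x) _
        (ha.comp measurable_prodMk_left)
        (g := fun y => F (x, y)) (by fun_prop)]
    rfl
  simp only [h1]
  rw [lintegral_add_left hm.lintegral_kernel_prod_right',
    hw.lintegral_eq hm.lintegral_kernel_prod_right']
  congr 2
  refine lintegral_congr fun x => ?_
  rw [← lintegral_const_mul (f := fun y => acceptProb w x y * F (x, y)) _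
    (hm.comp measurable_prodMk_left)]
  refine lintegral_congr fun y => ?_
  rw [← mul_assoc, ofReal_mul_acceptProb hw.pos]

/-- The accepted part inherits the symmetry of ν ⊗ Q and of the minimum; the diagonal is fixed by
the swap. -/
theorem IsUnnormalizedDensity.map_swap_compProd_metropolis [SFinite ν]
    (hw : IsUnnormalizedDensity π ν w) (hQ : ∀ x, Q x Set.univ ≤ 1)
    (hsymm : (ν ⊗ₘ Q).map Prod.swap = ν ⊗ₘ Q) :
    (π ⊗ₘ metropolis w hw.measurable Q).map Prod.swap = π ⊗ₘ metropolis w hw.measurable Q := by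
  refine Measure.ext_of_lintegral _ fun F hF => ?_
  rw [lintegral_map hF measurable_swap, hw.lintegral_compProd_metropolis hQ hF,
    hw.lintegral_compProd_metropolis hQ (F := fun p => F p.swap) (hF.comp measurable_swap)]
  have hm2 : Measurable fun p : G × G => ENNReal.ofReal (min (w p.1) (w p.2)) * F p :=
    ((hw.measurable.comp measurable_fst).min
      (hw.measurable.comp measurable_snd)).ennreal_ofReal.mul hF
  congr 2
  conv_rhs => rw [← hsymm, lintegral_map hm2 measurable_swap]
  refine lintegral_congr fun p => ?_
  simp [min_comm]

/-- On {w > t} one has ν ≤ (c / t) π. -/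
theorem IsUnnormalizedDensity.memLp_restrict_slice (hw : IsUnnormalizedDensity π ν w)
    {f : G → ℝ} (hf2 : MemLp f 2 π) {t : ℝ} (ht : 0 < t) :
    MemLp f 2 (ν.restrict (slice w t)) := by
  set c := ∫⁻ x, ENNReal.ofReal (w x) ∂ν with hc
  have h := hf2.restrict (slice w t)
  refine h.of_measure_le_smul (c := c * (ENNReal.ofReal t)⁻¹)
    (ENNReal.mul_ne_top hw.mass_ne_top (ENNReal.inv_ne_top.2 (ENNReal.ofReal_pos.2 ht).ne')) ?_
  refine Measure.le_iff.2 fun A hA => ?_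
  have hAs := hA.inter (measurableSet_slice hw.measurable t)
  rw [Measure.smul_apply, Measure.restrict_apply hA, Measure.restrict_apply hA, smul_eq_mul,
    hw.eq_withDensity, Measure.smul_apply, smul_eq_mul, withDensity_apply _ hAs, ← hc]
  have h1 : ENNReal.ofReal t * ν (A ∩ slice w t) ≤
      ∫⁻ x in A ∩ slice w t, ENNReal.ofReal (w x) ∂ν := by
    rw [← setLIntegral_const]
    exact setLIntegral_mono hw.measurable.ennreal_ofReal
      fun x hx => ENNReal.ofReal_le_ofReal (le_of_lt hx.2)
  calc ν (A ∩ slice w t)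
    _ = (c * c⁻¹) * ((ENNReal.ofReal t)⁻¹ * (ENNReal.ofReal t * ν (A ∩ slice w t))) := by
        rw [ENNReal.mul_inv_cancel hw.mass_ne_zero hw.mass_ne_top, one_mul, ← mul_assoc,
          ENNReal.inv_mul_cancel (ENNReal.ofReal_pos.2 ht).ne' ENNReal.ofReal_ne_top, one_mul]
    _ ≤ (c * c⁻¹) * ((ENNReal.ofReal t)⁻¹ * ∫⁻ x in A ∩ slice w t, ENNReal.ofReal (w x) ∂ν) := by
        gcongr
    _ = _ := by ring

/-! ### The general comparison -/

/-- Ideal slice sampling dominates every Metropolis kernel whose proposal is sub-Markov, reversible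
and positive semidefinite with respect to the reference measure. -/
theorem IsPositiveProposal.dominates [SFinite ν] (hQ : IsPositiveProposal ν Q)
    (hw : IsUnnormalizedDensity π ν w) :
    Dominates π (idealSlice ν w hw.measurable) (metropolis w hw.measurable Q) := by
  have := hw.isProbabilityMeasure
  have hU := hw.isMarkovKernel_idealSlice
  have hM := isMarkovKernel_metropolis hw.measurable hQ.le_one
  have hUr := isReversible_of_map_swap hw.map_swap_compProd_idealSlice
  have hMr := isReversible_of_map_swap (hw.map_swap_compProd_metropolis hQ.le_one hQ.map_swap)
  refine ⟨hU, hM, hUr, hMr, fun f₀ hf₀ _ => ?_⟩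
  have hae := hf₀.1.ae_eq_mk
  set f := hf₀.1.mk f₀
  have hf : Measurable f := hf₀.1.stronglyMeasurable_mk.measurable
  have hf2 : MemLp f 2 π := (memLp_congr_ae hae).1 hf₀
  rw [dirichletForm_congr_ae hUr.invariant hae, dirichletForm_congr_ae hMr.invariant hae]
  obtain ⟨hiU, heU⟩ := dirichletForm_eq_half hUr.invariant hf2
  obtain ⟨hiM, heM⟩ := dirichletForm_eq_half hMr.invariant hf2
  rw [heU, heM]
  refine mul_le_mul_of_nonneg_left ?_ (by norm_num)
  rw [← ENNReal.ofReal_le_ofReal_iff (integral_nonneg fun p => sq_nonneg _),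
    ofReal_integral_eq_lintegral_ofReal hiU (Filter.Eventually.of_forall fun p => sq_nonneg _),
    ofReal_integral_eq_lintegral_ofReal hiM (Filter.Eventually.of_forall fun p => sq_nonneg _)]
  have hF : Measurable fun p : G × G => ENNReal.ofReal ((f p.1 - f p.2) ^ 2) :=
    (((hf.comp measurable_fst).sub (hf.comp measurable_snd)).pow_const 2).ennreal_ofReal
  rw [hw.lintegral_compProd_idealSlice hF, hw.lintegral_compProd_metropolis hQ.le_one hF,
    lintegral_ofReal_min_mul hw.measurable hF]
  simp only [sub_self, ne_eq, OfNat.ofNat_ne_zero, not_false_eq_true, zero_pow, ENNReal.ofReal_zero,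
    mul_zero, lintegral_zero, add_zero]
  refine mul_le_mul_right ?_ _
  -- The rejection term is gone and c⁻¹ is common to both sides; the comparison is now level by
  -- level.
  refine lintegral_mono_ae ((ae_restrict_iff' measurableSet_Ioi).2
    (Filter.Eventually.of_forall fun t (ht : 0 < t) => ?_))
  exact hQ.setLIntegral_sq_sub_le (measurableSet_slice hw.measurable t)
    (hw.measure_slice_ne_top ht) hf (hw.memLp_restrict_slice hf2 ht)

end

/-! ### Proposals with a density -/

/-- A transition density of the form `k(x, y) = ∫ q(z, x) q(z, y) m(dz)` gives a positive
proposal. -/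
theorem isPositiveProposal_withDensity {G Z : Type*} [MeasurableSpace G] [MeasurableSpace Z]
    {ν : Measure G} [SFinite ν] {m : Measure Z} [SFinite m] {q : Z → G → ℝ≥0∞}
    (hq : Measurable (Function.uncurry q)) (hqtop : ∀ z x, q z x ≠ ∞) {k : G → G → ℝ≥0∞}
    (hk : Measurable (Function.uncurry k)) (hktop : ∀ x y, k x y ≠ ∞)
    (hqk : ∀ x y, ∫⁻ z, q z x * q z y ∂m = k x y)
    (hle : ∀ x, Kernel.withDensity (Kernel.const G ν) k x Set.univ ≤ 1) :
    IsPositiveProposal ν (Kernel.withDensity (Kernel.const G ν) k) := by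
  have : IsSFiniteKernel (Kernel.withDensity (Kernel.const G ν) k) :=
    Kernel.IsSFiniteKernel.withDensity _ hktop
  have hqz : ∀ z, Measurable (q z) := fun z => hq.comp measurable_prodMk_left
  have hK : IsSFiniteKernel (Kernel.withDensity (Kernel.const Z ν) q) :=
    Kernel.IsSFiniteKernel.withDensity _ hqtop
  refine isPositiveProposal_of_compProd_eq (m := m) (K := Kernel.withDensity (Kernel.const Z ν) q)
    hle ?_
  refine Measure.ext_of_lintegral _ fun F hF => ?_
  have hFx : ∀ x, Measurable fun y => F (x, y) := fun x => hF.comp measurable_prodMk_left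
  rw [Measure.lintegral_compProd hF, Measure.lintegral_bind (Kernel.aemeasurable _) hF.aemeasurable]
  have hR : ∀ z, ∫⁻ p, F p ∂((Kernel.withDensity (Kernel.const Z ν) q ×ₖ
      Kernel.withDensity (Kernel.const Z ν) q) z) =
      ∫⁻ p, q z p.1 * q z p.2 * F p ∂(ν.prod ν) := fun z => by
    have hz : Kernel.withDensity (Kernel.const Z ν) q z = ν.withDensity (q z) := by
      rw [Kernel.withDensity_apply _ hq, Kernel.const_apply]
    have : SFinite (ν.withDensity (q z)) := by
      rw [← hz]
      infer_instance
    rw [Kernel.prod_apply, hz, prod_withDensity (hqz z) (hqz z),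
      lintegral_withDensity_eq_lintegral_mul
      (f := fun p : G × G => q z p.1 * q z p.2) _ (by fun_prop) hF]
    rfl
  simp only [hR]
  have hjoint : Measurable fun u : Z × (G × G) => q u.1 u.2.1 * q u.1 u.2.2 * F u.2 :=
    ((hq.comp (measurable_fst.prodMk (measurable_fst.comp measurable_snd))).mul
      (hq.comp (measurable_fst.prodMk (measurable_snd.comp measurable_snd)))).mul
      (hF.comp measurable_snd)
  -- Integrating out the hidden variable z first turns the product of the q's into k.
  rw [lintegral_lintegral_swap (f := fun z p => q z p.1 * q z p.2 * F p) hjoint.aemeasurable]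
  have hI : ∀ p : G × G, ∫⁻ z, q z p.1 * q z p.2 * F p ∂m = k p.1 p.2 * F p := fun p => by
    rw [lintegral_mul_const (f := fun z => q z p.1 * q z p.2) _
      ((hq.comp measurable_prodMk_right).mul (hq.comp measurable_prodMk_right)), hqk]
  simp only [hI]
  rw [lintegral_prod (fun p : G × G => k p.1 p.2 * F p) (hk.mul hF).aemeasurable]
  refine lintegral_congr fun x => ?_
  rw [Kernel.lintegral_withDensity _ hk _ (hFx x), Kernel.const_apply]

/-! ### Gaussian random walk -/

section

variable {d : ℕ}

theorem gaussianStepDensity_nonneg (σ : ℝ) (x y : EuclideanSpace ℝ (Fin d)) :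
    0 ≤ gaussianStepDensity σ x y := by
  unfold gaussianStepDensity
  positivity

theorem lintegral_gaussianStepDensity {σ : ℝ} (hσ : 0 < σ) (x : EuclideanSpace ℝ (Fin d)) :
    ∫⁻ y, ENNReal.ofReal (gaussianStepDensity σ x y) = 1 := by
  have hb : 0 < (2 * σ ^ 2)⁻¹ := by positivity
  have hg := GaussianFourier.integral_rexp_neg_mul_sq_norm (V := EuclideanSpace ℝ (Fin d)) hb
  have hval : (Real.pi / (2 * σ ^ 2)⁻¹) ^ ((Module.finrank ℝ (EuclideanSpace ℝ (Fin d)) : ℝ) / 2) =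
      Real.sqrt (2 * Real.pi * σ ^ 2) ^ d := by
    rw [finrank_euclideanSpace_fin, div_inv_eq_mul, Real.sqrt_eq_rpow, ← Real.rpow_mul_natCast
      (by positivity)]
    congr 1 <;> ring
  rw [hval] at hg
  have hpos : 0 < Real.sqrt (2 * Real.pi * σ ^ 2) ^ d := by positivity
  have hint : ∫ y, gaussianStepDensity σ x y = 1 := by
    simp only [gaussianStepDensity]
    rw [integral_const_mul, integral_sub_left_eq_self
      (fun v : EuclideanSpace ℝ (Fin d) => Real.exp (-‖v‖ ^ 2 / (2 * σ ^ 2))) volume x]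
    have : ∀ v : EuclideanSpace ℝ (Fin d), Real.exp (-‖v‖ ^ 2 / (2 * σ ^ 2)) =
        Real.exp (-(2 * σ ^ 2)⁻¹ * ‖v‖ ^ 2) := fun v => by congr 1; ring
    simp only [this]
    rw [hg, ← mul_pow, inv_mul_cancel₀ (by positivity), one_pow]
  rw [← ofReal_integral_eq_lintegral_ofReal (integrable_of_integral_eq_one hint)
    (Filter.Eventually.of_forall fun y => gaussianStepDensity_nonneg σ x y), hint,
    ENNReal.ofReal_one]

/-- The product of two Gaussian densities with a common centre, split into the density of the
difference of their arguments and a density in the centre. -/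
theorem gaussianStepDensity_mul {σ τ ρ : ℝ} (hσ : 0 < σ) (hτ : 0 < τ) (hρ : 0 < ρ)
    (hστ : σ ^ 2 = 2 * τ ^ 2) (hτρ : τ ^ 2 = 2 * ρ ^ 2) (x y z : EuclideanSpace ℝ (Fin d)) :
    gaussianStepDensity τ z x * gaussianStepDensity τ z y =
      gaussianStepDensity σ x y * gaussianStepDensity ρ ((2⁻¹ : ℝ) • (x + y)) z := by
  have hc : Real.sqrt (2 * Real.pi * τ ^ 2) * Real.sqrt (2 * Real.pi * τ ^ 2) =
      Real.sqrt (2 * Real.pi * σ ^ 2) * Real.sqrt (2 * Real.pi * ρ ^ 2) := by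
    rw [← Real.sqrt_mul (by positivity), ← Real.sqrt_mul (by positivity)]
    congr 1
    rw [hστ, hτρ]
    ring
  have hn : 4 * ‖(2⁻¹ : ℝ) • (x + y) - z‖ ^ 2 + ‖x - y‖ ^ 2 = 2 * ‖z - x‖ ^ 2 + 2 * ‖z - y‖ ^ 2 := by
    -- The sum of z - x and z - y measures the distance from z to the midpoint; their difference is
    -- y - x up to sign.
    have h := parallelogram_law_with_norm ℝ (z - x) (z - y)
    have h1 : z - x + (z - y) = (-2 : ℝ) • ((2⁻¹ : ℝ) • (x + y) - z) := by module
    have h2 : z - x - (z - y) = -(x - y) := by abel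
    rw [h1, h2, norm_neg (x - y), norm_smul, norm_neg, Real.norm_two] at h
    linarith
  simp only [gaussianStepDensity]
  rw [mul_mul_mul_comm, mul_mul_mul_comm (_ ^ d) _ (_ ^ d), ← mul_pow, ← mul_pow, ← mul_inv,
    ← mul_inv, hc, ← Real.exp_add, ← Real.exp_add]
  congr 2
  rw [hστ, hτρ]
  field_simp
  linarith

/-- A Gaussian step is two independent steps of half the variance through an intermediate point z.
Given the endpoints, z is Gaussian about their midpoint with variance σ² / 4, and that density
integrates to one. -/
theorem lintegral_gaussianStepDensity_mul {σ : ℝ} (hσ : 0 < σ) (x y : EuclideanSpace ℝ (Fin d)) :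
    ∫⁻ z, ENNReal.ofReal (gaussianStepDensity (σ / Real.sqrt 2) z x) *
        ENNReal.ofReal (gaussianStepDensity (σ / Real.sqrt 2) z y) =
      ENNReal.ofReal (gaussianStepDensity σ x y) := by
  have h2 : Real.sqrt 2 ^ 2 = 2 := Real.sq_sqrt (by norm_num)
  have h : ∀ z, ENNReal.ofReal (gaussianStepDensity (σ / Real.sqrt 2) z x) *
        ENNReal.ofReal (gaussianStepDensity (σ / Real.sqrt 2) z y) =
      ENNReal.ofReal (gaussianStepDensity σ x y) *
        ENNReal.ofReal (gaussianStepDensity (σ / 2) ((2⁻¹ : ℝ) • (x + y)) z) := fun z => by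
    rw [← ENNReal.ofReal_mul (gaussianStepDensity_nonneg _ _ _),
      ← ENNReal.ofReal_mul (gaussianStepDensity_nonneg _ _ _),
      gaussianStepDensity_mul hσ (τ := σ / Real.sqrt 2) (ρ := σ / 2) (by positivity) (by positivity)
        (by rw [div_pow, h2]; ring) (by rw [div_pow, h2]; ring)]
  simp only [h]
  rw [lintegral_const_mul' _ _ ENNReal.ofReal_ne_top, lintegral_gaussianStepDensity (by positivity),
    mul_one]

theorem gaussianWalk_univ_le_one {S : Set (EuclideanSpace ℝ (Fin d))} (hS : MeasurableSet S)
    {σ : ℝ} (hσ : 0 < σ) (x : S) : gaussianWalk S σ x Set.univ ≤ 1 := by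
  rw [gaussianWalk_apply, withDensity_apply _ MeasurableSet.univ, Measure.restrict_univ, lebesgueOn,
    lintegral_subtype_comap hS
      (fun y => ENNReal.ofReal (gaussianStepDensity σ (x : EuclideanSpace ℝ (Fin d)) y)),
    ← lintegral_gaussianStepDensity hσ (x : EuclideanSpace ℝ (Fin d))]
  exact setLIntegral_le_lintegral _ _

/-- The intermediate point ranges over all of ℝ^d, so restricting the endpoints to S leaves the
factorization intact. -/
theorem isPositiveProposal_gaussianWalk {S : Set (EuclideanSpace ℝ (Fin d))}
    (hS : MeasurableSet S) {σ : ℝ} (hσ : 0 < σ) :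
    IsPositiveProposal (lebesgueOn S) (gaussianWalk S σ) := by
  have hq : Measurable (Function.uncurry fun (z : EuclideanSpace ℝ (Fin d)) (x : S) =>
      ENNReal.ofReal (gaussianStepDensity (σ / Real.sqrt 2) z x)) :=
    ((measurable_gaussianStepDensity (σ / Real.sqrt 2)).comp
      (measurable_id.prodMap measurable_subtype_coe)).ennreal_ofReal
  have hk : Measurable (Function.uncurry fun x y : S =>
      ENNReal.ofReal (gaussianStepDensity σ (x : EuclideanSpace ℝ (Fin d)) y)) :=
    ((measurable_gaussianStepDensity σ).comp
      (measurable_subtype_coe.prodMap measurable_subtype_coe)).ennreal_ofReal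
  exact isPositiveProposal_withDensity (m := (volume : Measure (EuclideanSpace ℝ (Fin d)))) hq
    (fun _ _ => ENNReal.ofReal_ne_top) hk (fun _ _ => ENNReal.ofReal_ne_top)
    (fun x y => lintegral_gaussianStepDensity_mul hσ _ _) (gaussianWalk_univ_le_one hS hσ)

end

/-! ### Independent proposals -/

/-- The draws are independent outright, so a one-point hidden space suffices. -/
theorem isPositiveProposal_const {G : Type*} [MeasurableSpace G] (ν : Measure G)
    [IsProbabilityMeasure ν] : IsPositiveProposal ν (Kernel.const G ν) := by
  refine isPositiveProposal_of_compProd_eq (m := Measure.dirac ()) (K := Kernel.const Unit ν)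
    (fun x => by simp) ?_
  rw [Measure.compProd_const, Measure.dirac_bind (Kernel.measurable _), Kernel.prod_apply,
    Kernel.const_apply]

/-! ### Preconditioned Crank–Nicolson proposals -/

section

variable {H : Type*} [NormedAddCommGroup H] [InnerProductSpace ℝ H]
  [SecondCountableTopology H] [MeasurableSpace H] [BorelSpace H]

theorem IsGaussianWith.map_const_smul {C : H →L[ℝ] H} {μ : Measure H} (hμ : IsGaussianWith 0 C μ)
    (s : ℝ) : IsGaussianWith 0 (s ^ 2 • C) (μ.map fun x => s • x) := by
  have := hμ.isGaussian
  refine ⟨isGaussian_map (s • ContinuousLinearMap.id ℝ H), ?_, fun u v => ?_⟩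
  · rw [integral_map (by fun_prop) (by fun_prop), integral_smul, hμ.mean, smul_zero]
  · have h := hμ.cov u v
    simp only [sub_zero] at h ⊢
    rw [integral_map (by fun_prop) (by fun_prop), smul_apply,
      real_inner_smul_left, ← h, ← integral_const_mul]
    refine integral_congr_ae (Filter.Eventually.of_forall fun x => ?_)
    simp only [real_inner_smul_right]
    ring

/-- The kernel sending `x` to the law of `a x + b W` with `W` distributed according to `μ`. -/
noncomputable def autoregressiveKernel (μ : Measure H) (a b : ℝ) : Kernel H H :=
  (Kernel.id ×ₖ Kernel.const H μ).map fun p => a • p.1 + b • p.2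

instance (μ : Measure H) [SFinite μ] (a b : ℝ) : IsSFiniteKernel (autoregressiveKernel μ a b) := by
  unfold autoregressiveKernel
  infer_instance

theorem autoregressiveKernel_apply (μ : Measure H) [SFinite μ] (a b : ℝ) (x : H) :
    autoregressiveKernel μ a b x = μ.map fun y => a • x + b • y := by
  rw [autoregressiveKernel, Kernel.map_apply _ (by fun_prop), Kernel.prod_apply, Kernel.id_apply,
    Kernel.const_apply, Measure.dirac_prod, Measure.map_map (by fun_prop) (by fun_prop)]
  rfl

theorem compProd_autoregressiveKernel (μ : Measure H) [SFinite μ] (a b : ℝ) :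
    μ ⊗ₘ autoregressiveKernel μ a b = (μ.prod μ).map fun p => (p.1, a • p.1 + b • p.2) := by
  refine Measure.ext_of_lintegral _ fun F hF => ?_
  rw [Measure.lintegral_compProd hF, lintegral_map hF (by fun_prop),
    lintegral_prod (fun p : H × H => F (p.1, a • p.1 + b • p.2))
      (hF.comp (by fun_prop)).aemeasurable]
  refine lintegral_congr fun x => ?_
  rw [autoregressiveKernel_apply, lintegral_map (f := fun y => F (x, y)) (by fun_prop) (by fun_prop)]

theorem prod_autoregressiveKernel_comp (μ : Measure H) [SFinite μ] (a b : ℝ) :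
    (autoregressiveKernel μ a b ×ₖ autoregressiveKernel μ a b) ∘ₘ μ =
      (μ.prod (μ.prod μ)).map fun p => (a • p.1 + b • p.2.1, a • p.1 + b • p.2.2) := by
  refine Measure.ext_of_lintegral _ fun F hF => ?_
  rw [Measure.lintegral_bind (Kernel.aemeasurable _) hF.aemeasurable,
    lintegral_map hF (by fun_prop), lintegral_prod
      (fun p : H × H × H => F (a • p.1 + b • p.2.1, a • p.1 + b • p.2.2))
      (hF.comp (by fun_prop)).aemeasurable]
  refine lintegral_congr fun x => ?_
  rw [Kernel.prod_apply, autoregressiveKernel_apply, Measure.map_prod_map _ _ (by fun_prop)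
    (by fun_prop), lintegral_map hF (by fun_prop)]
  rfl

variable [CompleteSpace H]

theorem IsGaussianWith.pcnProposal_eq {C : H →L[ℝ] H} {μ : Measure H} (hμ : IsGaussianWith 0 C μ)
    (s : ℝ) : pcnProposal C s = autoregressiveKernel μ (Real.sqrt (1 - s ^ 2)) s := by
  have := hμ.isGaussian
  ext x : 1
  have h := (hμ.map_const_smul s).map_add (Real.sqrt (1 - s ^ 2) • x)
  rw [add_zero, Measure.map_map (by fun_prop) (by fun_prop)] at h
  rw [autoregressiveKernel_apply]
  exact h.gaussianMeasure_eq

theorem IsGaussianWith.charFunDual_eq {C : H →L[ℝ] H} {μ : Measure H} (hμ : IsGaussianWith 0 C μ)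
    (L : StrongDual ℝ H) :
    charFunDual μ L = Complex.exp (-(covarianceBilinDual μ L L : ℝ) / 2) := by
  have := hμ.isGaussian
  rw [IsGaussian.charFunDual_eq, covarianceBilinDual_self_eq_variance IsGaussian.memLp_two_id]
  have : ∫ x, L x ∂μ = 0 := by
    have h := L.integral_comp_comm (IsGaussian.integrable_id (μ := μ))
    simpa only [id_eq, hμ.mean, map_zero] using h
  rw [integral_complex_ofReal, this]
  congr 1
  push_cast
  ring

/-- Both sides are linear images of centred Gaussian product measures, so covariances decide: each
coordinate has covariance `C`, and the cross-covariance is r `C` on the left and a² `C` on the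
right. -/
theorem IsGaussianWith.map_autoregressive_eq {C : H →L[ℝ] H} {μ : Measure H}
    (hμ : IsGaussianWith 0 C μ) {a b r s : ℝ} (ha : a ^ 2 = r) (hab : a ^ 2 + b ^ 2 = 1)
    (hrs : r ^ 2 + s ^ 2 = 1) :
    (μ.prod μ).map (fun p => (p.1, r • p.1 + s • p.2)) =
      (μ.prod (μ.prod μ)).map fun p => (a • p.1 + b • p.2.1, a • p.1 + b • p.2.2) := by
  have := hμ.isGaussian
  let T₁ : H × H →L[ℝ] H × H :=
    (ContinuousLinearMap.fst ℝ H H).prod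
      (r • ContinuousLinearMap.fst ℝ H H + s • ContinuousLinearMap.snd ℝ H H)
  let T₂ : H × (H × H) →L[ℝ] H × H :=
    (a • ContinuousLinearMap.fst ℝ H (H × H) + b • (ContinuousLinearMap.fst ℝ H H).comp
      (ContinuousLinearMap.snd ℝ H (H × H))).prod
    (a • ContinuousLinearMap.fst ℝ H (H × H) + b • (ContinuousLinearMap.snd ℝ H H).comp
      (ContinuousLinearMap.snd ℝ H (H × H)))
  change (μ.prod μ).map T₁ = (μ.prod (μ.prod μ)).map T₂
  have : IsFiniteMeasure ((μ.prod μ).map T₁) := Measure.isFiniteMeasure_map _ _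
  have : IsFiniteMeasure ((μ.prod (μ.prod μ)).map T₂) := Measure.isFiniteMeasure_map _ _
  refine Measure.ext_of_charFunDual ?_
  ext L
  set L₁ : StrongDual ℝ H := L.comp (.inl ℝ H H) with hL₁
  set L₂ : StrongDual ℝ H := L.comp (.inr ℝ H H) with hL₂
  have hL : ∀ x y, L (x, y) = L₁ x + L₂ y := fun x y => by
    rw [← L.comp_inl_add_comp_inr]
  rw [charFunDual_map, charFunDual_map, charFunDual_prod, charFunDual_prod, charFunDual_prod]
  have e1 : (L.comp T₁).comp (.inl ℝ H H) = L₁ + r • L₂ := by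
    ext x; simp [T₁, hL]
  have e2 : (L.comp T₁).comp (.inr ℝ H H) = s • L₂ := by
    ext x; simp [T₁, hL]
  have e3 : (L.comp T₂).comp (.inl ℝ H (H × H)) = a • (L₁ + L₂) := by
    ext x; simp [T₂, hL]
  have e4 : ((L.comp T₂).comp (.inr ℝ H (H × H))).comp (.inl ℝ H H) = b • L₁ := by
    ext x; simp [T₂, hL]
  have e5 : ((L.comp T₂).comp (.inr ℝ H (H × H))).comp (.inr ℝ H H) = b • L₂ := by
    ext x; simp [T₂, hL]
  rw [e1, e2, e3, e4, e5]
  simp only [hμ.charFunDual_eq, ← Complex.exp_add]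
  congr 1
  norm_cast
  simp only [_root_.map_add, map_smul, add_apply, smul_apply,
    smul_eq_mul, covarianceBilinDual_comm L₂ L₁]
  subst ha
  -- The two relations normalize the diagonal terms; the mixed terms already agree because r = a².
  linear_combination (-(covarianceBilinDual μ L₂ L₂) / 2) * hrs +
    (covarianceBilinDual μ L₁ L₁ + covarianceBilinDual μ L₂ L₂) / 2 * hab

theorem isPositiveProposal_pcnProposal {C : H →L[ℝ] H} (hC : IsGaussianCovariance C) {s : ℝ}
    (hs : s ∈ Set.Icc (0 : ℝ) 1) : IsPositiveProposal (gaussianMeasure 0 C) (pcnProposal C s) := by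
  obtain ⟨μ, hμ⟩ := hC
  have := hμ.isGaussian
  rw [hμ.gaussianMeasure_eq, hμ.pcnProposal_eq]
  have h1 : 0 ≤ 1 - s ^ 2 := by nlinarith [hs.1, hs.2]
  set r := Real.sqrt (1 - s ^ 2) with hr
  have hr0 : 0 ≤ r := Real.sqrt_nonneg _
  have hr2 : r ^ 2 = 1 - s ^ 2 := Real.sq_sqrt h1
  have hr1 : r ≤ 1 := Real.sqrt_le_one.2 (by nlinarith [hs.1])
  -- The hidden variable has law μ, and both states are autoregressive steps from it with
  -- coefficient √r, giving correlation r. This needs r ≥ 0; the noise coefficient √(1 - r) keeps μ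
  -- stationary.
  refine isPositiveProposal_of_compProd_eq (m := μ)
    (K := autoregressiveKernel μ (Real.sqrt r) (Real.sqrt (1 - r))) (fun x => ?_) ?_
  · rw [autoregressiveKernel_apply, Measure.map_apply (by fun_prop) MeasurableSet.univ]
    simp
  · rw [compProd_autoregressiveKernel, prod_autoregressiveKernel_comp]
    refine hμ.map_autoregressive_eq (Real.sq_sqrt hr0) ?_ (by linarith)
    rw [Real.sq_sqrt hr0, Real.sq_sqrt (by linarith)]
    ring

end

/-! ### The three proposals -/

theorem mainTheorem10 :
    -- Random Walk Metropolis with Gaussian proposal on a Borel set `S ⊆ ℝ^d`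
    (∀ (d : ℕ) (S : Set (EuclideanSpace ℝ (Fin d))), MeasurableSet S →
      ∀ (π : Measure S) (w : S → ℝ) (hw : IsUnnormalizedDensity π (lebesgueOn S) w) (σ : ℝ),
        0 < σ →
        Dominates π (idealSlice (lebesgueOn S) w hw.measurable)
          (metropolis w hw.measurable (gaussianWalk S σ))) ∧
    -- Independent Metropolis on a general probability space
    (∀ (G : Type*) [MeasurableSpace G] (ν : Measure G) [IsProbabilityMeasure ν] (π : Measure G)
      (w : G → ℝ) (hw : IsUnnormalizedDensity π ν w),
        Dominates π (idealSlice ν w hw.measurable)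
          (metropolis w hw.measurable (Kernel.const G ν))) ∧
    -- preconditioned Crank–Nicolson Metropolis on a separable Hilbert space
    (∀ (H : Type*) [NormedAddCommGroup H] [InnerProductSpace ℝ H] [CompleteSpace H]
      [SecondCountableTopology H] [MeasurableSpace H] [BorelSpace H] (C : H →L[ℝ] H),
      IsGaussianCovariance C → Function.Injective C →
      ∀ (π : Measure H) (w : H → ℝ) (hw : IsUnnormalizedDensity π (gaussianMeasure 0 C) w)
        (s : ℝ), s ∈ Set.Icc (0 : ℝ) 1 →
        Dominates π (idealSlice (gaussianMeasure 0 C) w hw.measurable)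
          (metropolis w hw.measurable (pcnProposal C s))) := by
  refine ⟨fun d S hS π w hw σ hσ => ?_, fun G _ ν _ π w hw => ?_,
    fun H _ _ _ _ _ _ C hC _ π w hw s hs => ?_⟩
  · exact (isPositiveProposal_gaussianWalk hS hσ).dominates hw
  · exact (isPositiveProposal_const ν).dominates hw
  · have : SFinite (gaussianMeasure 0 C) := by
      obtain ⟨μ, hμ⟩ := hC
      have := hμ.isGaussian
      rw [hμ.gaussianMeasure_eq]
      infer_instance
    exact (isPositiveProposal_pcnProposal hC hs).dominates hw
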